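/- Let $(W,\mathcal F,\mu)$ be a probability space and $H=L^2(W,\mu,\mathbb R)$ with its usual scalar product $(\cdot,\cdot)$ and norm $\|\cdot\|$; write $1\in H$ for the constant function $1$ and identify a number with the corresponding constant function. Let the following data be given. - (D2) A strongly continuous semigroup $(T_t)_{t\ge 0}$ of bounded linear operators on $H$ with generator $(L,D(L))$. - (D3) A dense linear subspace $D\subset D(L)$ of $H$ which is an operator core for $(L,D(L))$. - (D4) A symmetric operator $(S,D(S))$ and a closed antisymmetric operator $(A,D(A))$ on $H$ with $D\subset D(S)\cap D(A)$ and $L=S-A$ on $D$. - (D5) An orthogonal projection $P:H\to H$ with $P(H)\subset D(S)$, $SP=0$, $P(D)\subset D(A)$ and $AP(D)\subset D(A)$. Set $P_Sf=Pf+(f,1)$ for $f\in H$. - (D6) $(Lf,1)=\int_W Lf\,d\mu=0$ for all $f\in D$. - (D7) $1\in D(L)$ and $L1=0$. Let $AP$ have its natural domain $\{f\in H: Pf\in D(A)\}$ (it is closed and densely defined), and let $B$ be the unique extension to a bounded linear operator on $H$ of the operator $(I+(AP)^*AP)^{-1}(AP)^*$ defined on $D((AP)^*)$. Let $\Lambda_m,\Lambda_M\in(0,\infty)$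 and $c_1,c_2\in\mathbb R$ be constants such that - (A1) $PAPf=0$ for all $f\in D$; - (A2) $-(Sf,f)\ge \Lambda_m\|(I-P_S)f\|^2$ for all $f\in D$; - (A3) the operator $G=PA^2P$ with domain $D$ is essentially self-adjoint on $H$, and $\|APf\|^2\ge\Lambda_M\|Pf\|^2$ for all $f\in D$; - (A4) $\|BSf\|\le c_1\|(I-P)f\|$ and $\|BA(I-P)f\|\le c_2\|(I-P)f\|$ for all $f\in D$. Then for each $\theta_1\in(1,\infty)$ there exists $\theta_2\in(0,\infty)$ such that for all $g\in H$ and all $t\ge 0$ $$\|T_tg-(g,1)\|\le\theta_1e^{-\theta_2t}\|g-(g,1)\|.$$ Moreover, for each $\theta_1\in(1,\infty)$ this estimate holds for all $g\in H$ and $t\ge0$ with $$\theta_2=\frac14\,\frac{\theta_1-1}{\theta_1}\,\frac{\min\{\Lambda_m,c_1\}}{(1+c_1+c_2)\left(1+\frac{1+\Lambda_M}{2\Lambda_M}(1+c_1+c_2)\right)+\frac12\frac{\Lambda_M}{1+\Lambda_M}}\,\frac{\Lambda_M}{1+\Lambda_M},$$ and this number is strictly positive whenever $c_1>0$. -/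

import Mathlib

open MeasureTheory Filter Topology
open scoped NNReal LinearPMap

namespace Hypocoercivity

section Operators

/-- A strongly continuous one-parameter semigroup of bounded linear operators. -/
structure IsC0Semigroup {E : Type*} [NormedAddCommGroup E] [NormedSpace ℝ E]
    (T : ℝ≥0 → E →L[ℝ] E) : Prop where
  zero : ∀ x, T 0 x = x
  add : ∀ s t x, T (s + t) x = T s (T t x)
  continuous : ∀ x, Continuous fun t => T t x

/-- `L` is the infinitesimal generator of `T`: `x` lies in the domain of `L` with `L x = y` if and
only if the difference quotients `(T t x - x) / t` converge to `y` as `t` decreases to `0`. -/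
def IsGenerator {E : Type*} [NormedAddCommGroup E] [NormedSpace ℝ E]
    (T : ℝ≥0 → E →L[ℝ] E) (L : E →ₗ.[ℝ] E) : Prop :=
  ∀ x y : E, (x, y) ∈ L.graph ↔
    Tendsto (fun t : ℝ≥0 => (t : ℝ)⁻¹ • (T t x - x)) (𝓝[>] 0) (𝓝 y)

variable {E : Type*} [NormedAddCommGroup E] [InnerProductSpace ℝ E]

/-- `(S f, g) = (f, S g)` on the domain of `S`. -/
def IsSymm (S : E →ₗ.[ℝ] E) : Prop :=
  ∀ f g : S.domain, inner ℝ (S f) (g : E) = inner ℝ (f : E) (S g)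

/-- `(A f, g) = -(f, A g)` on the domain of `A`. -/
def IsAntisymm (A : E →ₗ.[ℝ] E) : Prop :=
  ∀ f g : A.domain, inner ℝ (A f) (g : E) = -inner ℝ (f : E) (A g)

/-- The closure of `G` is self-adjoint (equal to its adjoint; in particular densely defined). -/
def IsEssentiallySelfAdjoint [CompleteSpace E] (G : E →ₗ.[ℝ] E) : Prop :=
  IsSelfAdjoint G.closure

/-- The composition `A P` of a partially defined operator `A` with an everywhere defined operator
`P`, on its natural domain `{f | P f ∈ D(A)}`. -/
def compRight (A : E →ₗ.[ℝ] E) (P : E →L[ℝ] E) : E →ₗ.[ℝ] E where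
  domain := A.domain.comap (P : E →ₗ[ℝ] E)
  toFun := A.toFun.comp ((P : E →ₗ[ℝ] E).restrict fun _ h => h)

theorem compRight_apply (A : E →ₗ.[ℝ] E) (P : E →L[ℝ] E) (f : (compRight A P).domain) :
    compRight A P f = A ⟨P f, f.2⟩ := rfl

theorem compRight_isClosed {A : E →ₗ.[ℝ] E} (hA : A.IsClosed) (P : E →L[ℝ] E) :
    (compRight A P).IsClosed := by
  have h : ((compRight A P).graph : Set (E × E)) =
      (fun z : E × E => (P z.1, z.2)) ⁻¹' (A.graph : Set (E × E)) := by
    ext ⟨x, y⟩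
    simp only [SetLike.mem_coe, Set.mem_preimage, LinearPMap.mem_graph_iff]
    constructor
    · rintro ⟨z, rfl, rfl⟩
      exact ⟨⟨P z, z.2⟩, rfl, rfl⟩
    · rintro ⟨⟨z, hz⟩, h1, rfl⟩
      obtain rfl : z = P x := h1
      exact ⟨⟨x, hz⟩, rfl, rfl⟩
  unfold LinearPMap.IsClosed
  rw [h]
  exact IsClosed.preimage (by fun_prop) hA

variable [CompleteSpace E]

/-- `B` is a bounded operator on the whole space which equals `(I + T* T)⁻¹ T*` on `D(T*)`: for
`g ∈ D(T*)` the vector `u = B g` lies in `D(T* T)` and solves `u + T* T u = T* g`. -/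
def ExtendsResolventAdjoint (T : E →ₗ.[ℝ] E) (B : E →L[ℝ] E) : Prop :=
  ∀ g : T†.domain, ∃ (u : T.domain) (hu : T u ∈ T†.domain),
    B g = u ∧ (u : E) + T† ⟨T u, hu⟩ = T† g

/-- Orthogonal decomposition of `(0, g)` along the graph of a closed densely defined operator. -/
theorem exists_graph_decomposition {T : E →ₗ.[ℝ] E} (hc : T.IsClosed)
    (hd : Dense (T.domain : Set E)) :
    ∃ B : E →L[ℝ] E, ∀ g : E, ∃ (u : T.domain) (hw : g - T u ∈ T†.domain),
      B g = u ∧ T† ⟨g - T u, hw⟩ = u := by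
  let e := WithLp.prodContinuousLinearEquiv 2 ℝ E E
  let K : Submodule ℝ (WithLp 2 (E × E)) := T.graph.comap e.toLinearEquiv.toLinearMap
  have hK : IsClosed (K : Set (WithLp 2 (E × E))) := IsClosed.preimage e.continuous hc
  have : CompleteSpace K := hK.completeSpace_coe
  refine ⟨(ContinuousLinearMap.fst ℝ E E).comp ((e : WithLp 2 (E × E) →L[ℝ] E × E).comp
    (K.starProjection.comp ((e.symm : E × E →L[ℝ] WithLp 2 (E × E)).comp
      (ContinuousLinearMap.inr ℝ E E)))), fun g => ?_⟩
  let z : WithLp 2 (E × E) := e.symm (0, g)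
  have hm : e (K.starProjection z) ∈ T.graph := K.starProjection_apply_mem z
  obtain ⟨u, hu1, hu2⟩ := (LinearPMap.mem_graph_iff T).1 hm
  have key : ∀ x : T.domain, inner ℝ (u : E) (x : E) = inner ℝ (g - T u) (T x) := by
    intro x
    have hx : e.symm ((x : E), T x) ∈ K := by
      change e (e.symm ((x : E), T x)) ∈ T.graph
      rw [e.apply_symm_apply]
      exact T.mem_graph x
    have h0 := K.starProjection_inner_eq_zero z _ hx
    have h1 : (K.starProjection z).fst = u := hu1.symm
    have h2 : (K.starProjection z).snd = T u := hu2.symm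
    have h3 : z.fst = 0 := rfl
    have h4 : z.snd = g := rfl
    have h5 : (e.symm ((x : E), T x)).fst = x := rfl
    have h6 : (e.symm ((x : E), T x)).snd = T x := rfl
    rw [WithLp.prod_inner_apply] at h0
    change inner ℝ (z.fst - (K.starProjection z).fst) (e.symm ((x : E), T x)).fst +
      inner ℝ (z.snd - (K.starProjection z).snd) (e.symm ((x : E), T x)).snd = 0 at h0
    rw [h1, h2, h3, h4, h5, h6, zero_sub, inner_neg_left] at h0
    linarith
  have hw : g - T u ∈ T†.domain := LinearPMap.mem_adjoint_domain_of_exists _ ⟨u, key⟩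
  exact ⟨u, hw, hu1.symm, LinearPMap.adjoint_apply_eq hd ⟨_, hw⟩ key⟩

/-- The bounded extension of `(I + T* T)⁻¹ T*` exists for closed densely defined `T`. -/
theorem exists_extendsResolventAdjoint {T : E →ₗ.[ℝ] E} (hc : T.IsClosed)
    (hd : Dense (T.domain : Set E)) : ∃ B : E →L[ℝ] E, ExtendsResolventAdjoint T B := by
  obtain ⟨B, hB⟩ := exists_graph_decomposition hc hd
  refine ⟨B, fun g => ?_⟩
  obtain ⟨u, hw, h1, h2⟩ := hB g
  have hu : T u ∈ T†.domain := by
    have := T†.domain.sub_mem g.2 hw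
    simpa using this
  refine ⟨u, hu, h1, ?_⟩
  have h3 : (⟨(g : E) - T u, hw⟩ : T†.domain) = g - ⟨T u, hu⟩ := rfl
  rw [h3, LinearPMap.map_sub] at h2
  rw [← h2]
  abel

/-- The bounded extension of `(I + T* T)⁻¹ T*` is unique for closed densely defined `T`. -/
theorem extendsResolventAdjoint_unique {T : E →ₗ.[ℝ] E} (hc : T.IsClosed)
    (hd : Dense (T.domain : Set E)) {B B' : E →L[ℝ] E} (hB : ExtendsResolventAdjoint T B)
    (hB' : ExtendsResolventAdjoint T B') : B = B' := by
  have hdense : Dense (T†.domain : Set E) := by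
    rw [Submodule.dense_iff_topologicalClosure_eq_top,
      Submodule.topologicalClosure_eq_top_iff, Submodule.eq_bot_iff]
    intro g hg
    obtain ⟨B, hB⟩ := exists_graph_decomposition hc hd
    obtain ⟨u, hw, -, h2⟩ := hB g
    have h3 : inner ℝ (g - T u) g = 0 := (Submodule.mem_orthogonal _ g).1 hg _ hw
    have h4 := LinearPMap.adjoint_isFormalAdjoint hd ⟨_, hw⟩ u
    rw [h2] at h4
    have h5 : inner ℝ (g - T u) (g - T u) + inner ℝ (u : E) (u : E) = 0 := by
      rw [h4]
      change inner ℝ (g - T u) (g - T u) + inner ℝ (g - T u) (T u) = 0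
      rw [← inner_add_right, sub_add_cancel]
      exact h3
    have h6 : (u : E) = 0 := by
      have a := real_inner_self_nonneg (x := g - T u)
      have b := real_inner_self_nonneg (x := (u : E))
      exact inner_self_eq_zero.1 (by linarith : inner ℝ (u : E) (u : E) = 0)
    have h7 : u = 0 := Subtype.ext h6
    rw [h7] at h5
    simpa using h5
  refine ContinuousLinearMap.coeFn_injective
    (Continuous.ext_on hdense B.continuous B'.continuous fun g hg => ?_)
  obtain ⟨u, hu, e1, e2⟩ := hB ⟨g, hg⟩
  obtain ⟨v, hv, f1, f2⟩ := hB' ⟨g, hg⟩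
  have hs : ((u - v : T.domain) : E) + T† (⟨T u, hu⟩ - ⟨T v, hv⟩) = 0 := by
    rw [LinearPMap.map_sub]
    have : (u : E) + T† ⟨T u, hu⟩ = v + T† ⟨T v, hv⟩ := e2.trans f2.symm
    rw [Submodule.coe_sub, sub_add_sub_comm, this, sub_self]
  have h4 := LinearPMap.adjoint_isFormalAdjoint hd (⟨T u, hu⟩ - ⟨T v, hv⟩) (u - v)
  rw [← neg_eq_of_add_eq_zero_right hs, inner_neg_left, LinearPMap.map_sub] at h4
  change -inner ℝ ((u - v : T.domain) : E) ((u - v : T.domain) : E) =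
    inner ℝ (T u - T v) (T u - T v) at h4
  have a := real_inner_self_nonneg (x := T u - T v)
  have b := real_inner_self_nonneg (x := ((u - v : T.domain) : E))
  have h6 := inner_self_eq_zero.1
    (by linarith : inner ℝ ((u - v : T.domain) : E) ((u - v : T.domain) : E) = 0)
  have h7 : (u : E) = v := sub_eq_zero.1 h6
  exact e1.trans (h7.trans f1.symm)

end Operators

/-- The Hilbert space `L²(W, μ, ℝ)`. -/
abbrev L2 {W : Type*} [MeasurableSpace W] (μ : Measure W) := Lp ℝ 2 μ

/-- The constant function `1` in `L²(W, μ, ℝ)`. -/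
noncomputable def one {W : Type*} [MeasurableSpace W] (μ : Measure W) [IsProbabilityMeasure μ] :
    L2 μ := Lp.const 2 μ 1

/-- The constant function with value `(g, 1)`. -/
noncomputable def mean {W : Type*} [MeasurableSpace W] (μ : Measure W) [IsProbabilityMeasure μ]
    (g : L2 μ) : L2 μ := (inner ℝ g (one μ) : ℝ) • one μ

/-- The hypocoercivity data on `L²(W, μ, ℝ)` for a probability space `(W, μ)`. -/
structure Data {W : Type*} [MeasurableSpace W] (μ : Measure W) [IsProbabilityMeasure μ] where
  /-- the strongly continuous semigroup -/
  T : ℝ≥0 → L2 μ →L[ℝ] L2 μ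
  isC0Semigroup : IsC0Semigroup T
  /-- the generator of the semigroup -/
  L : L2 μ →ₗ.[ℝ] L2 μ
  isGenerator : IsGenerator T L
  /-- the core -/
  D : Submodule ℝ (L2 μ)
  dense_D : Dense (D : Set (L2 μ))
  core : L.HasCore D
  /-- the symmetric part -/
  S : L2 μ →ₗ.[ℝ] L2 μ
  /-- the antisymmetric part -/
  A : L2 μ →ₗ.[ℝ] L2 μ
  symm : IsSymm S
  antisymm : IsAntisymm A
  closed_A : A.IsClosed
  le_S : D ≤ S.domain
  le_A : D ≤ A.domain
  decomposition : ∀ f (hf : f ∈ D), L ⟨f, core.le_domain hf⟩ = S ⟨f, le_S hf⟩ - A ⟨f, le_A hf⟩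
  /-- the orthogonal projection -/
  P : L2 μ →L[ℝ] L2 μ
  isProjection : IsStarProjection P
  P_mem_S : ∀ f, P f ∈ S.domain
  S_P : ∀ f, S ⟨P f, P_mem_S f⟩ = 0
  P_mem_A : ∀ f ∈ D, P f ∈ A.domain
  AP_mem_A : ∀ f (hf : f ∈ D), A ⟨P f, P_mem_A f hf⟩ ∈ A.domain
  /-- invariance of the measure -/
  invariant : ∀ f (hf : f ∈ D), inner ℝ (L ⟨f, core.le_domain hf⟩) (one μ) = 0
  /-- conservativity of the semigroup -/
  one_mem : one μ ∈ L.domain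
  L_one : L ⟨one μ, one_mem⟩ = 0

namespace Data

variable {W : Type*} [MeasurableSpace W] {μ : Measure W} [IsProbabilityMeasure μ] (𝒟 : Data μ)

/-- The operator `P_S f = P f + (f, 1)`. -/
noncomputable def PS (f : L2 μ) : L2 μ := 𝒟.P f + mean μ f

/-- The operator `A P` on its natural domain `{f | P f ∈ D(A)}`. -/
noncomputable def AP : L2 μ →ₗ.[ℝ] L2 μ := compRight 𝒟.A 𝒟.P

theorem AP_isClosed : 𝒟.AP.IsClosed := compRight_isClosed 𝒟.closed_A 𝒟.P

theorem dense_AP : Dense (𝒟.AP.domain : Set (L2 μ)) := 𝒟.dense_D.mono fun f hf => 𝒟.P_mem_A f hf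

/-- The operator `B`: the unique extension of `(I + (AP)* AP)⁻¹ (AP)*` on `D((AP)*)` to a bounded
linear operator on the whole space. -/
noncomputable def B : L2 μ →L[ℝ] L2 μ :=
  (exists_extendsResolventAdjoint 𝒟.AP_isClosed 𝒟.dense_AP).choose

theorem B_spec : ExtendsResolventAdjoint 𝒟.AP 𝒟.B :=
  (exists_extendsResolventAdjoint 𝒟.AP_isClosed 𝒟.dense_AP).choose_spec

theorem le_AP : 𝒟.D ≤ 𝒟.AP.domain := fun f hf => 𝒟.P_mem_A f hf

/-- The operator `G = P A² P` with domain `D`. -/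
noncomputable def G : L2 μ →ₗ.[ℝ] L2 μ where
  domain := 𝒟.D
  toFun := (𝒟.P : L2 μ →ₗ[ℝ] L2 μ) ∘ₗ 𝒟.A.toFun ∘ₗ
    LinearMap.codRestrict 𝒟.A.domain (𝒟.AP.toFun ∘ₗ Submodule.inclusion 𝒟.le_AP)
      fun f => 𝒟.AP_mem_A f f.2

theorem G_apply (f : L2 μ) (hf : f ∈ 𝒟.D) :
    𝒟.G ⟨f, hf⟩ = 𝒟.P (𝒟.A ⟨𝒟.A ⟨𝒟.P f, 𝒟.P_mem_A f hf⟩, 𝒟.AP_mem_A f hf⟩) := rfl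

/-- `P A P = 0` on `D`. -/
def AlgebraicRelation : Prop :=
  ∀ f (hf : f ∈ 𝒟.D), 𝒟.P (𝒟.A ⟨𝒟.P f, 𝒟.P_mem_A f hf⟩) = 0

/-- `-(S f, f) ≥ Λ ‖(I - P_S) f‖²` on `D`. -/
def MicroscopicCoercivity (Λ : ℝ) : Prop :=
  ∀ f (hf : f ∈ 𝒟.D), Λ * ‖f - 𝒟.PS f‖ ^ 2 ≤ -inner ℝ (𝒟.S ⟨f, 𝒟.le_S hf⟩) f

/-- `(G, D)` is essentially self-adjoint and `‖A P f‖² ≥ Λ ‖P f‖²` on `D`. -/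
def MacroscopicCoercivity (Λ : ℝ) : Prop :=
  IsEssentiallySelfAdjoint 𝒟.G ∧
    ∀ f (hf : f ∈ 𝒟.D), Λ * ‖𝒟.P f‖ ^ 2 ≤ ‖𝒟.A ⟨𝒟.P f, 𝒟.P_mem_A f hf⟩‖ ^ 2

theorem sub_P_mem_A {f : L2 μ} (hf : f ∈ 𝒟.D) : f - 𝒟.P f ∈ 𝒟.A.domain :=
  𝒟.A.domain.sub_mem (𝒟.le_A hf) (𝒟.P_mem_A f hf)

/-- `‖B S f‖ ≤ c₁ ‖(I - P) f‖` and `‖B A (I - P) f‖ ≤ c₂ ‖(I - P) f‖` on `D`. -/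
def AuxiliaryBounds (c₁ c₂ : ℝ) : Prop :=
  ∀ f (hf : f ∈ 𝒟.D),
    ‖𝒟.B (𝒟.S ⟨f, 𝒟.le_S hf⟩)‖ ≤ c₁ * ‖f - 𝒟.P f‖ ∧
    ‖𝒟.B (𝒟.A ⟨f - 𝒟.P f, 𝒟.sub_P_mem_A hf⟩)‖ ≤ c₂ * ‖f - 𝒟.P f‖

end Data

/-- The explicit rate of convergence. -/
noncomputable def rate (Λm ΛM c₁ c₂ θ₁ : ℝ) : ℝ :=
  1 / 4 * ((θ₁ - 1) / θ₁) *
    (min Λm c₁ /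
      ((1 + c₁ + c₂) * (1 + (1 + ΛM) / (2 * ΛM) * (1 + c₁ + c₂)) + 1 / 2 * (ΛM / (1 + ΛM)))) *
    (ΛM / (1 + ΛM))

end Hypocoercivity

/-!
The decay is obtained from the modified entropy `H f = ½ ‖f‖² + ε (B f, f)`. The norm alone does not
decay exponentially: its dissipation `-(S f, f)` controls only `(I - P) f`. The correction term
supplies the missing part, because with `T = A P` one has `B T = T* T (I + T* T)⁻¹`, and the
spectrum of `T* T` on the range of `P` lies above `ΛM`, so that `(B A P f, f) ≥ λ ‖P f‖²` with
`λ = ΛM / (1 + ΛM)` (`Data.MacroscopicCoercivity.inner_B`). No spectral calculus is used: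
essential self-adjointness of `G = -T* T` on `D` extends the bound `‖T f‖² ≥ ΛM ‖P f‖²` to the domain
of `T* T` (`Data.MacroscopicCoercivity.le_of_inner`), and the rest is the Cauchy-Schwarz inequality.

Every other term in the derivative of `H` carries a factor `(I - P) f`: those with `B S` and
`B A (I - P)` by assumption, and `(B f, L f) = (A B f, f)` since `B` maps into the range of `P` and
`‖A B f‖ ≤ ‖(I - P) f‖` (`Data.A_B_bound`). Young's inequality absorbs them when `ε` is small
(`Data.dissipation`). This inequality is proved on the core, with the mean of `f` kept as a separate
term, and passes to the domain of `L`, which is invariant under the semigroup. Finally `‖B‖ ≤ ½`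
makes `H` comparable to the square of the norm, and the choice of `ε` turns the comparison constants
into `θ₁` (`Data.norm_T_sub_mean_le`).

The constants `c₁` and `c₂` are not assumed to be nonnegative, but this follows from the other
assumptions (`Data.AuxiliaryBounds.nonneg`). For `c₁ = 0` the explicit rate is zero, and the
existence of a positive rate follows by enlarging `c₁`.
-/

namespace Hypocoercivity

/-! ### Unbounded operators and the operator `B` -/

section Operators

variable {E : Type*} [NormedAddCommGroup E] [InnerProductSpace ℝ E]

/-- This holds without closability: a non-closable operator is its own closure by convention. -/
theorem graph_closure_le (G : E →ₗ.[ℝ] E) : G.closure.graph ≤ G.graph.topologicalClosure := by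
  by_cases h : G.IsClosable
  · exact h.graph_closure_eq_closure_graph.ge
  · rw [LinearPMap.closure_def' h]
    exact G.graph.le_topologicalClosure

theorem graph_closure_subset_of_isClosed {G : E →ₗ.[ℝ] E} {s : Set (E × E)} (hs : IsClosed s)
    (h : ∀ x : G.domain, ((x : E), G x) ∈ s) {z : E × E} (hz : z ∈ G.closure.graph) : z ∈ s := by
  have h1 : z ∈ _root_.closure (G.graph : Set (E × E)) := by
    rw [← Submodule.topologicalClosure_coe]
    exact graph_closure_le G hz
  refine closure_minimal (fun w hw => ?_) hs h1
  obtain ⟨y, rfl⟩ := (LinearPMap.mem_graph_iff' G).1 hw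
  exact h y

variable [CompleteSpace E]

/-- If the closure of `G` is self-adjoint, then every pair in the graph of the adjoint of `G` is a
limit of pairs in the graph of `G`, so it lies in each closed set containing that graph. -/
theorem IsEssentiallySelfAdjoint.mem_of_isClosed {G : E →ₗ.[ℝ] E}
    (hG : IsEssentiallySelfAdjoint G) {s : Set (E × E)} (hs : IsClosed s)
    (h : ∀ x : G.domain, ((x : E), G x) ∈ s) {w v : E}
    (hwv : ∀ x : G.domain, inner ℝ v (x : E) = inner ℝ w (G x)) : (w, v) ∈ s := by
  have key : ∀ x : G.closure.domain, inner ℝ v (x : E) = inner ℝ w (G.closure x) := fun x =>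
    graph_closure_subset_of_isClosed (s := {z | inner ℝ v z.1 = inner ℝ w z.2})
      (isClosed_eq (by fun_prop) (by fun_prop)) hwv (G.closure.mem_graph x)
  have hd : Dense (G.closure.domain : Set E) := IsSelfAdjoint.dense_domain hG
  have hw := LinearPMap.mem_adjoint_domain_of_exists w ⟨v, key⟩
  have hv := LinearPMap.adjoint_apply_eq hd ⟨w, hw⟩ key
  refine graph_closure_subset_of_isClosed hs h ?_
  have h1 : (w, v) ∈ (G.closure†).graph := by
    rw [← hv]
    exact (G.closure†).mem_graph ⟨w, hw⟩
  rwa [LinearPMap.isSelfAdjoint_def.1 hG] at h1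

/-- The decomposition `g = T u + (g - T u)` with `u = B g` and `T* (g - T u) = u` describes `B` on
the whole space, not only on the domain of `T*`. -/
theorem ExtendsResolventAdjoint.exists_decomposition {T : E →ₗ.[ℝ] E} (hc : T.IsClosed)
    (hd : Dense (T.domain : Set E)) {B : E →L[ℝ] E} (hB : ExtendsResolventAdjoint T B) (g : E) :
    ∃ u : T.domain, B g = u ∧ ∀ x : T.domain, inner ℝ (u : E) (x : E) = inner ℝ (g - T u) (T x) := by
  obtain ⟨B', hB'⟩ := exists_graph_decomposition hc hd
  have hE : ExtendsResolventAdjoint T B' := by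
    intro g
    obtain ⟨u, hw, h1, h2⟩ := hB' g
    have hu : T u ∈ T†.domain := by
      have := T†.domain.sub_mem g.2 hw
      simpa using this
    refine ⟨u, hu, h1, ?_⟩
    have h3 : (⟨(g : E) - T u, hw⟩ : T†.domain) = g - ⟨T u, hu⟩ := rfl
    rw [h3, LinearPMap.map_sub] at h2
    rw [← h2]
    abel
  obtain rfl := extendsResolventAdjoint_unique hc hd hB hE
  obtain ⟨u, hw, h1, h2⟩ := hB' g
  refine ⟨u, h1, fun x => ?_⟩
  rw [← h2]
  exact LinearPMap.adjoint_isFormalAdjoint hd _ x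

theorem ExtendsResolventAdjoint.norm_apply_le {T : E →ₗ.[ℝ] E} (hc : T.IsClosed)
    (hd : Dense (T.domain : Set E)) {B : E →L[ℝ] E} (hB : ExtendsResolventAdjoint T B) (g : E) :
    ‖B g‖ ≤ 1 / 2 * ‖g‖ := by
  obtain ⟨u, h1, h2⟩ := hB.exists_decomposition hc hd g
  have h3 := h2 u
  rw [inner_sub_left, real_inner_self_eq_norm_sq, real_inner_self_eq_norm_sq] at h3
  have h4 := real_inner_le_norm g (T u)
  rw [h1]
  refine abs_le_of_sq_le_sq' ?_ (by positivity) |>.2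
  nlinarith [sq_nonneg (‖g‖ - 2 * ‖T u‖)]

end Operators

theorem norm_one_eq {W : Type*} [MeasurableSpace W] (μ : Measure W) [IsProbabilityMeasure μ] :
    ‖one μ‖ = 1 := by
  refine (Lp.norm_const (p := 2) (μ := μ) (c := (1 : ℝ)) two_ne_zero).trans ?_
  simp

namespace Data

variable {W : Type*} [MeasurableSpace W] {μ : Measure W} [IsProbabilityMeasure μ] {𝒟 : Data μ}

theorem inner_P (f g : L2 μ) : inner ℝ (𝒟.P f) g = inner ℝ f (𝒟.P g) :=
  
  (ContinuousLinearMap.isStarProjection_iff_isSymmetricProjection.1 𝒟.isProjection).isSymmetric f g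

theorem P_P (f : L2 μ) : 𝒟.P (𝒟.P f) = 𝒟.P f := by
  have h : 𝒟.P * 𝒟.P = 𝒟.P := 𝒟.isProjection.isIdempotentElem
  exact congrArg (fun Q : L2 μ →L[ℝ] L2 μ => Q f) h

theorem inner_P_self (f : L2 μ) : inner ℝ (𝒟.P f) f = ‖𝒟.P f‖ ^ 2 := by
  rw [← real_inner_self_eq_norm_sq, inner_P (𝒟.P f) f |>.symm, P_P]

theorem norm_sq_eq (f : L2 μ) : ‖f‖ ^ 2 = ‖f - 𝒟.P f‖ ^ 2 + ‖𝒟.P f‖ ^ 2 := by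
  rw [norm_sub_sq_real, real_inner_comm, inner_P_self]
  ring

theorem inner_A_self {f : L2 μ} (hf : f ∈ 𝒟.A.domain) : inner ℝ (𝒟.A ⟨f, hf⟩) f = 0 := by
  have h := 𝒟.antisymm ⟨f, hf⟩ ⟨f, hf⟩
  rw [real_inner_comm] at h
  rw [real_inner_comm]
  dsimp only at h
  linarith

/-- `P (A P) = 0` extends from `D` to the natural domain of `A P`, because the range of `P A P` is
orthogonal to `D` by antisymmetry. -/
theorem P_AP_eq_zero (hA1 : 𝒟.AlgebraicRelation) (u : 𝒟.AP.domain) : 𝒟.P (𝒟.AP u) = 0 := by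
  refine 𝒟.dense_D.eq_zero_of_inner_left ℝ fun g hg => ?_
  rw [inner_P]
  have h := 𝒟.antisymm ⟨𝒟.P u, u.2⟩ ⟨𝒟.P g, 𝒟.P_mem_A g hg⟩
  refine h.trans ?_
  dsimp only
  rw [inner_P, hA1 g hg, inner_zero_right, neg_zero]

theorem B_apply (g : L2 μ) : ∃ u : 𝒟.AP.domain, 𝒟.B g = u ∧
    ∀ x : 𝒟.AP.domain, inner ℝ (u : L2 μ) (x : L2 μ) = inner ℝ (g - 𝒟.AP u) (𝒟.AP x) :=
  𝒟.B_spec.exists_decomposition 𝒟.AP_isClosed 𝒟.dense_AP g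

theorem norm_B_le (g : L2 μ) : ‖𝒟.B g‖ ≤ 1 / 2 * ‖g‖ :=
  𝒟.B_spec.norm_apply_le 𝒟.AP_isClosed 𝒟.dense_AP g

/-- A vector representing a functional `x ↦ (v, A P x)` lies in the range of `P`. -/
theorem P_eq_self_of_inner {u v : L2 μ}
    (h : ∀ x : 𝒟.AP.domain, inner ℝ u (x : L2 μ) = inner ℝ v (𝒟.AP x)) : 𝒟.P u = u := by
  refine 𝒟.dense_AP.eq_of_inner_left ℝ fun x hx => ?_
  have hPx : 𝒟.P x ∈ 𝒟.AP.domain := by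
    change 𝒟.P (𝒟.P x) ∈ 𝒟.A.domain
    rw [P_P]
    exact hx
  rw [inner_P, h ⟨_, hPx⟩, h ⟨x, hx⟩]
  have h1 : 𝒟.AP ⟨𝒟.P x, hPx⟩ = 𝒟.AP ⟨x, hx⟩ := by
    change 𝒟.A ⟨𝒟.P (𝒟.P x), _⟩ = 𝒟.A ⟨𝒟.P x, _⟩
    congr 2
    exact P_P x
  rw [h1]

/-- `B f` lies in the range of `P` and in the domain of `A`, and `‖A B f‖ ≤ ‖(I - P) f‖`. -/
theorem A_B_bound (hA1 : 𝒟.AlgebraicRelation) (f : L2 μ) :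
    𝒟.P (𝒟.B f) = 𝒟.B f ∧ ∃ h : 𝒟.B f ∈ 𝒟.A.domain, ‖𝒟.A ⟨𝒟.B f, h⟩‖ ≤ ‖f - 𝒟.P f‖ := by
  obtain ⟨u, h1, h2⟩ := 𝒟.B_apply f
  have hP : 𝒟.P u = u := P_eq_self_of_inner h2
  have hu : (u : L2 μ) ∈ 𝒟.A.domain := hP ▸ u.2
  have hAu : 𝒟.AP u = 𝒟.A ⟨u, hu⟩ := by
    change 𝒟.A ⟨𝒟.P u, _⟩ = _
    congr 2
  rw [h1]
  refine ⟨hP, hu, ?_⟩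
  rw [← hAu]
  have h3 := h2 u
  have h4 : inner ℝ (𝒟.P f) (𝒟.AP u) = 0 := by
    rw [inner_P, P_AP_eq_zero hA1, inner_zero_right]
  have h5 := real_inner_le_norm (f - 𝒟.P f) (𝒟.AP u)
  rw [inner_sub_left, h4] at h5
  rw [inner_sub_left, real_inner_self_eq_norm_sq, real_inner_self_eq_norm_sq] at h3
  by_contra! hlt
  nlinarith [norm_nonneg (f - 𝒟.P f), sq_nonneg ‖(u : L2 μ)‖]

/-- Essential self-adjointness of `(G, D)` makes `D` a core for `(AP)* AP`; so the lower bound on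
`A P` extends to the vectors `w` for which `v = (AP)* AP w` exists. -/
theorem MacroscopicCoercivity.le_of_inner {Λ : ℝ} (h : 𝒟.MacroscopicCoercivity Λ)
    {w : 𝒟.AP.domain} {v : L2 μ}
    (hv : ∀ x : 𝒟.AP.domain, inner ℝ v (x : L2 μ) = inner ℝ (𝒟.AP w) (𝒟.AP x)) :
    Λ * ‖𝒟.P w‖ ^ 2 ≤ ‖𝒟.AP w‖ ^ 2 := by
  -- On `D` the operator `G` represents the form `-(AP ·, AP ·)`.
  have hG : ∀ (x : 𝒟.G.domain) (y : 𝒟.AP.domain),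
      inner ℝ (𝒟.AP y) (𝒟.AP ⟨x, 𝒟.le_AP x.2⟩) = -inner ℝ (y : L2 μ) (𝒟.G x) := by
    rintro ⟨x, hx⟩ y
    rw [𝒟.G_apply x hx, ← inner_P]
    exact 𝒟.antisymm ⟨𝒟.P y, y.2⟩ ⟨_, 𝒟.AP_mem_A x hx⟩
  have hcl : IsClosed {z : L2 μ × L2 μ | Λ * ‖𝒟.P z.1‖ ^ 2 ≤ -inner ℝ z.2 z.1} :=
    isClosed_le (by fun_prop) (by fun_prop)
  have hmem := h.1.mem_of_isClosed hcl (w := w) (v := -v) (fun x => ?_) (fun x => ?_)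
  · change Λ * ‖𝒟.P w‖ ^ 2 ≤ -inner ℝ (-v) (w : L2 μ) at hmem
    rwa [inner_neg_left, neg_neg, hv w, real_inner_self_eq_norm_sq] at hmem
  · change Λ * ‖𝒟.P (x : L2 μ)‖ ^ 2 ≤ -inner ℝ (𝒟.G x) (x : L2 μ)
    rw [real_inner_comm, ← hG x ⟨x, 𝒟.le_AP x.2⟩, real_inner_self_eq_norm_sq]
    exact h.2 x x.2
  · rw [inner_neg_left, hv ⟨x, 𝒟.le_AP x.2⟩, hG x w, neg_neg]

/-- With `T = A P` one has `B T = T* T (I + T* T)⁻¹`, and `s / (1 + s)` is increasing in `s ≥ Λ`. -/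
theorem MacroscopicCoercivity.inner_B {Λ : ℝ} (hΛ : 0 < Λ) (h : 𝒟.MacroscopicCoercivity Λ)
    {f : L2 μ} (hf : f ∈ 𝒟.D) :
    Λ / (1 + Λ) * ‖𝒟.P f‖ ^ 2 ≤ inner ℝ (𝒟.B (𝒟.A ⟨𝒟.P f, 𝒟.P_mem_A f hf⟩)) f := by
  obtain ⟨u, h1, h2⟩ := 𝒟.B_apply (𝒟.A ⟨𝒟.P f, 𝒟.P_mem_A f hf⟩)
  rw [h1]
  -- `w = f - u` is `(I + T* T)⁻¹ f`, and `u = T* T w`.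
  let w : 𝒟.AP.domain := ⟨f, 𝒟.le_AP hf⟩ - u
  have hw : 𝒟.AP w = 𝒟.A ⟨𝒟.P f, 𝒟.P_mem_A f hf⟩ - 𝒟.AP u := LinearPMap.map_sub _ _ _
  rw [← hw] at h2
  have hP : 𝒟.P u = u := P_eq_self_of_inner h2
  have hPw : 𝒟.P f = 𝒟.P w + u := by
    change 𝒟.P f = 𝒟.P (f - u) + u
    rw [map_sub, hP, sub_add_cancel]
  have hq : inner ℝ (u : L2 μ) (𝒟.P w) = ‖𝒟.AP w‖ ^ 2 := by
    rw [← inner_P, hP, h2 w, real_inner_self_eq_norm_sq]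
  have h3 := h.le_of_inner h2
  have h4 := real_inner_le_norm (u : L2 μ) (𝒟.P w)
  have h5 : inner ℝ (u : L2 μ) f = ‖𝒟.AP w‖ ^ 2 + ‖(u : L2 μ)‖ ^ 2 := by
    conv_lhs => rw [← hP, inner_P, hPw, inner_add_right, hq, real_inner_self_eq_norm_sq]
  have h6 : ‖𝒟.P f‖ ^ 2 = ‖𝒟.P w‖ ^ 2 + 2 * ‖𝒟.AP w‖ ^ 2 + ‖(u : L2 μ)‖ ^ 2 := by
    rw [hPw, norm_add_sq_real, real_inner_comm, hq]
  rw [hq] at h4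
  rw [h5, h6, div_mul_eq_mul_div, div_le_iff₀ (by linarith)]
  generalize ‖𝒟.AP w‖ ^ 2 = q at *
  generalize ‖𝒟.P w‖ = n at *
  have hm0 := norm_nonneg (u : L2 μ)
  generalize ‖(u : L2 μ)‖ = m at *
  have hmq : Λ * q ≤ m ^ 2 := by
    have hq0 : 0 ≤ q := by nlinarith [sq_nonneg n]
    -- Cauchy-Schwarz gives `q² ≤ m² n²`, and `Λ n² ≤ q`.
    have h7 : Λ * q * q ≤ m ^ 2 * q := by
      have : q ^ 2 ≤ (m * n) ^ 2 := pow_le_pow_left₀ hq0 h4 2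
      nlinarith [mul_le_mul_of_nonneg_left h3 (sq_nonneg m)]
    rcases hq0.eq_or_lt with h8 | h8
    · rw [← h8]
      nlinarith [sq_nonneg m]
    · exact le_of_mul_le_mul_right h7 h8
  nlinarith

/-- If one of the constants `c₁`, `c₂` were negative, then `P = I`, and `P A P = 0` would contradict
the lower bound on `A P`. -/
theorem AuxiliaryBounds.nonneg {Λ c₁ c₂ : ℝ} (hΛ : 0 < Λ) (hA1 : 𝒟.AlgebraicRelation)
    (hA3 : 𝒟.MacroscopicCoercivity Λ) (h : 𝒟.AuxiliaryBounds c₁ c₂) : 0 ≤ c₁ ∧ 0 ≤ c₂ := by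
  have hone : one μ ≠ 0 := by
    intro h0
    have h1 := norm_one_eq μ
    rw [h0, norm_zero] at h1
    exact zero_ne_one h1
  obtain ⟨f, hf, hPf⟩ : ∃ f ∈ 𝒟.D, f - 𝒟.P f ≠ 0 := by
    by_contra! hall
    refine hone (𝒟.dense_D.eq_zero_of_inner_left ℝ fun f hf => ?_)
    have h1 : 𝒟.P f = f := (sub_eq_zero.1 (hall f hf)).symm
    have h2 : 𝒟.A ⟨𝒟.P f, 𝒟.P_mem_A f hf⟩ = 0 := by
      refine 𝒟.dense_D.eq_zero_of_inner_left ℝ fun g hg => ?_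
      rw [sub_eq_zero.1 (hall g hg), ← inner_P, hA1 f hf, inner_zero_left]
    have h3 := hA3.2 f hf
    rw [h2, norm_zero, h1] at h3
    have h4 : ‖f‖ = 0 := by
      have : ‖f‖ ^ 2 = 0 := by nlinarith [sq_nonneg ‖f‖]
      simpa using this
    rw [norm_eq_zero.1 h4, inner_zero_right]
  have hpos := norm_pos_iff.2 hPf
  obtain ⟨h1, h2⟩ := h f hf
  exact ⟨nonneg_of_mul_nonneg_left ((norm_nonneg _).trans h1) hpos,
    nonneg_of_mul_nonneg_left ((norm_nonneg _).trans h2) hpos⟩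

/-! ### The dissipation inequality -/

/-- A property of the pairs `(f, L f)` which is closed in the graph topology extends from the core
to the domain of the generator. -/
theorem mem_of_isClosed_of_core {s : Set (L2 μ × L2 μ)} (hs : IsClosed s)
    (h : ∀ f (hf : f ∈ 𝒟.D), (f, 𝒟.L ⟨f, 𝒟.core.le_domain hf⟩) ∈ s) (f : 𝒟.L.domain) :
    ((f : L2 μ), 𝒟.L f) ∈ s := by
  refine graph_closure_subset_of_isClosed (G := 𝒟.L.domRestrict 𝒟.D) hs (fun x => ?_) ?_
  · have hx : (x : L2 μ) ∈ 𝒟.D := x.2.1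
    have hLx : 𝒟.L.domRestrict 𝒟.D x = 𝒟.L ⟨x, 𝒟.core.le_domain hx⟩ :=
      LinearPMap.domRestrict_apply rfl
    rw [hLx]
    exact h x hx
  · rw [𝒟.core.closure_eq]
    exact 𝒟.L.mem_graph f

theorem inner_L_one (f : 𝒟.L.domain) : inner ℝ (𝒟.L f) (one μ) = 0 :=
  mem_of_isClosed_of_core (s := {z | inner ℝ z.2 (one μ) = 0})
    (isClosed_eq (by fun_prop) (by fun_prop)) 𝒟.invariant f

theorem dissipation_of_mem_core {Λm ΛM c₁ c₂ ε : ℝ} (hΛM : 0 < ΛM) (hε : 0 ≤ ε)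
    (hA1 : 𝒟.AlgebraicRelation) (hA2 : 𝒟.MicroscopicCoercivity Λm)
    (hA3 : 𝒟.MacroscopicCoercivity ΛM) (hA4 : 𝒟.AuxiliaryBounds c₁ c₂)
    {f : L2 μ} (hf : f ∈ 𝒟.D) :
    inner ℝ (𝒟.L ⟨f, 𝒟.core.le_domain hf⟩) f +
      ε * (inner ℝ (𝒟.B (𝒟.L ⟨f, 𝒟.core.le_domain hf⟩)) f +
        inner ℝ (𝒟.B f) (𝒟.L ⟨f, 𝒟.core.le_domain hf⟩)) ≤
    -(Λm * ‖f - 𝒟.PS f‖ ^ 2) - ε * (ΛM / (1 + ΛM) * ‖𝒟.P f‖ ^ 2) +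
      ε * ((1 + c₁ + c₂) * (‖f - 𝒟.P f‖ * ‖f‖)) := by
  obtain ⟨hPB, hBA, hBn⟩ := A_B_bound hA1 f
  obtain ⟨hc1, hc2⟩ := hA4 f hf
  have hmic := hA2 f hf
  have hmac := hA3.inner_B hΛM hf
  have hA : 𝒟.A ⟨f, 𝒟.le_A hf⟩ = 𝒟.A ⟨𝒟.P f, 𝒟.P_mem_A f hf⟩ +
      𝒟.A ⟨f - 𝒟.P f, 𝒟.sub_P_mem_A hf⟩ := by
    rw [← LinearPMap.map_add]
    congr 1
    ext1
    simp
  have e1 : inner ℝ (𝒟.A ⟨f, 𝒟.le_A hf⟩) f = 0 := inner_A_self _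
  have e2 : inner ℝ (𝒟.B f) (𝒟.S ⟨f, 𝒟.le_S hf⟩) = 0 := by
    have h := 𝒟.symm ⟨𝒟.P (𝒟.B f), 𝒟.P_mem_S _⟩ ⟨f, 𝒟.le_S hf⟩
    rw [𝒟.S_P, inner_zero_left] at h
    rw [← hPB]
    exact h.symm
  have e3 := 𝒟.antisymm ⟨𝒟.B f, hBA⟩ ⟨f, 𝒟.le_A hf⟩
  dsimp only at e3
  have i1 : inner ℝ (𝒟.A ⟨𝒟.B f, hBA⟩) f ≤ ‖f - 𝒟.P f‖ * ‖f‖ :=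
    (real_inner_le_norm _ _).trans (mul_le_mul_of_nonneg_right hBn (norm_nonneg f))
  have i2 : inner ℝ (𝒟.B (𝒟.S ⟨f, 𝒟.le_S hf⟩)) f ≤ c₁ * ‖f - 𝒟.P f‖ * ‖f‖ :=
    (real_inner_le_norm _ _).trans (mul_le_mul_of_nonneg_right hc1 (norm_nonneg f))
  have i3 : -inner ℝ (𝒟.B (𝒟.A ⟨f - 𝒟.P f, 𝒟.sub_P_mem_A hf⟩)) f ≤
      c₂ * ‖f - 𝒟.P f‖ * ‖f‖ :=
    (neg_le_abs _).trans ((abs_real_inner_le_norm _ _).trans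
      (mul_le_mul_of_nonneg_right hc2 (norm_nonneg f)))
  rw [𝒟.decomposition f hf, map_sub, inner_sub_left, inner_sub_left, inner_sub_right, e1, e2, hA,
    map_add, inner_add_left, ← hA]
  have hsum : inner ℝ (𝒟.B (𝒟.S ⟨f, 𝒟.le_S hf⟩)) f -
      (inner ℝ (𝒟.B (𝒟.A ⟨𝒟.P f, 𝒟.P_mem_A f hf⟩)) f +
        inner ℝ (𝒟.B (𝒟.A ⟨f - 𝒟.P f, 𝒟.sub_P_mem_A hf⟩)) f) +
      (0 - inner ℝ (𝒟.B f) (𝒟.A ⟨f, 𝒟.le_A hf⟩)) ≤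
      (1 + c₁ + c₂) * (‖f - 𝒟.P f‖ * ‖f‖) - ΛM / (1 + ΛM) * ‖𝒟.P f‖ ^ 2 := by
    linarith
  have := mul_le_mul_of_nonneg_left hsum hε
  linarith

/-- The left-hand side is the derivative of `½ ‖f‖² + ε (B f, f)` along the flow. -/
theorem dissipation {Λm ΛM c₁ c₂ ε : ℝ} (hΛM : 0 < ΛM) (hε : 0 ≤ ε)
    (hA1 : 𝒟.AlgebraicRelation) (hA2 : 𝒟.MicroscopicCoercivity Λm)
    (hA3 : 𝒟.MacroscopicCoercivity ΛM) (hA4 : 𝒟.AuxiliaryBounds c₁ c₂)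
    (hεr : ε * ((1 + c₁ + c₂) * (1 + (1 + ΛM) / (2 * ΛM) * (1 + c₁ + c₂)) +
      1 / 2 * (ΛM / (1 + ΛM))) ≤ Λm)
    (f : 𝒟.L.domain) (hf : inner ℝ (f : L2 μ) (one μ) = 0) :
    inner ℝ (𝒟.L f) (f : L2 μ) +
      ε * (inner ℝ (𝒟.B (𝒟.L f)) (f : L2 μ) + inner ℝ (𝒟.B f) (𝒟.L f)) ≤
    -(ε * (1 / 2 * (ΛM / (1 + ΛM))) * ‖(f : L2 μ)‖ ^ 2) := by
  -- The estimate on the core is extended first; the mean is not controlled by approximation in `D`.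
  have h := mem_of_isClosed_of_core (𝒟 := 𝒟)
    (s := {z | inner ℝ z.2 z.1 + ε * (inner ℝ (𝒟.B z.2) z.1 + inner ℝ (𝒟.B z.1) z.2) ≤
      -(Λm * ‖z.1 - (𝒟.P z.1 + (inner ℝ z.1 (one μ) : ℝ) • one μ)‖ ^ 2) -
        ε * (ΛM / (1 + ΛM) * ‖𝒟.P z.1‖ ^ 2) +
        ε * ((1 + c₁ + c₂) * (‖z.1 - 𝒟.P z.1‖ * ‖z.1‖))})
    (isClosed_le (by fun_prop) (by fun_prop))
    (fun f hf => dissipation_of_mem_core hΛM hε hA1 hA2 hA3 hA4 hf) f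
  rw [Set.mem_ofPred_eq, hf, zero_smul, add_zero] at h
  refine h.trans ?_
  obtain ⟨h1, h2⟩ := hA4.nonneg hΛM hA1 hA3
  have hN := norm_sq_eq (𝒟 := 𝒟) (f : L2 μ)
  have hle : ‖(f : L2 μ)‖ ≤ ‖(f : L2 μ) - 𝒟.P f‖ + ‖𝒟.P f‖ := by
    simpa using norm_add_le ((f : L2 μ) - 𝒟.P f) (𝒟.P f)
  have ha := norm_nonneg ((f : L2 μ) - 𝒟.P f)
  generalize ‖(f : L2 μ) - 𝒟.P f‖ = a at *
  generalize ‖𝒟.P f‖ = b at *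
  generalize ‖(f : L2 μ)‖ = N at *
  rw [hN]
  have hC : 0 ≤ 1 + c₁ + c₂ := by linarith
  generalize 1 + c₁ + c₂ = C at *
  have hinv : (1 + ΛM) / (2 * ΛM) = 1 / (2 * (ΛM / (1 + ΛM))) := by
    field_simp
  rw [hinv] at hεr
  have hl : 0 < ΛM / (1 + ΛM) := by positivity
  generalize ΛM / (1 + ΛM) = l at *
  -- Young's inequality with the weight that absorbs half of the macroscopic term.
  have hY : C * (a * N) ≤ C * (1 + 1 / (2 * l) * C) * a ^ 2 + 1 / 2 * l * b ^ 2 := by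
    have h3 : C * (a * N) ≤ C * (a * (a + b)) := by gcongr
    have h4 : C * (1 + 1 / (2 * l) * C) * a ^ 2 + 1 / 2 * l * b ^ 2 - C * (a * (a + b)) =
        (C * a - l * b) ^ 2 / (2 * l) := by
      field_simp
      ring
    have h5 : 0 ≤ (C * a - l * b) ^ 2 / (2 * l) := by positivity
    linarith
  have h6 := mul_le_mul_of_nonneg_left hY hε
  have h7 := mul_le_mul_of_nonneg_right hεr (sq_nonneg a)
  linarith

end Data
/-! ### Semigroup orbits and decay of the modified entropy -/

section Semigroup

variable {E : Type*} [NormedAddCommGroup E] [NormedSpace ℝ E] {T : ℝ≥0 → E →L[ℝ] E}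
  {L : E →ₗ.[ℝ] E}

theorem IsC0Semigroup.mem_graph (hT : IsC0Semigroup T) (hL : IsGenerator T L) (x : L.domain)
    (t : ℝ≥0) : (T t x, T t (L x)) ∈ L.graph := by
  rw [hL]
  have h := (hL x (L x)).1 (L.mem_graph x)
  refine (((T t).continuous.tendsto _).comp h).congr fun s => ?_
  rw [Function.comp_apply, map_smul, map_sub, ← hT.add, ← hT.add, add_comm]

/-- Orbits starting in the domain of the generator are differentiable from the right, as functions
of a real time which is truncated at `0`. -/
theorem IsC0Semigroup.hasDerivWithinAt (hT : IsC0Semigroup T) (hL : IsGenerator T L) (x : L.domain)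
    {t : ℝ} (ht : 0 ≤ t) :
    HasDerivWithinAt (fun s : ℝ => T s.toNNReal x) (T t.toNNReal (L x)) (Set.Ici t) t := by
  rw [hasDerivWithinAt_iff_tendsto_slope, Set.Ici_sdiff_left]
  have h := (hL _ _).1 (hT.mem_graph hL x t.toNNReal)
  have hmap : Tendsto (fun s : ℝ => (s - t).toNNReal) (𝓝[>] t) (𝓝[>] 0) := by
    refine tendsto_nhdsWithin_iff.2 ⟨?_, ?_⟩
    · have hc : Continuous fun s : ℝ => (s - t).toNNReal := by fun_prop
      have := (hc.tendsto t).mono_left (nhdsWithin_le_nhds (s := Set.Ioi t))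
      simpa using this
    · filter_upwards [self_mem_nhdsWithin] with s hs
      exact Real.toNNReal_pos.2 (sub_pos.2 hs)
  refine (h.comp hmap).congr' ?_
  filter_upwards [self_mem_nhdsWithin] with s hs
  have hst : t < s := hs
  have e : (s - t).toNNReal + t.toNNReal = s.toNNReal := by
    rw [← Real.toNNReal_add (by linarith) ht, sub_add_cancel]
  rw [Function.comp_apply, slope_def_module, ← hT.add, e, Real.coe_toNNReal _ (by linarith)]

theorem IsC0Semigroup.continuous_toNNReal (hT : IsC0Semigroup T) (x : E) :
    Continuous fun s : ℝ => T s.toNNReal x :=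
  (hT.continuous x).comp continuous_real_toNNReal

/-- A bounded linear map which vanishes on the orbit of `L x` is constant on the orbit of `x`. -/
theorem IsC0Semigroup.apply_eq_of_generator (hT : IsC0Semigroup T) (hL : IsGenerator T L)
    {F : Type*} [NormedAddCommGroup F] [NormedSpace ℝ F] (φ : E →L[ℝ] F) (x : L.domain)
    (h : ∀ t, φ (T t (L x)) = 0) (t : ℝ≥0) : φ (T t x) = φ x := by
  have h1 := constant_of_has_deriv_right_zero (f := fun s : ℝ => φ (T s.toNNReal x)) (a := 0)
    (b := t) (φ.continuous.comp (hT.continuous_toNNReal x)).continuousOn (fun s hs => by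
      have := φ.hasFDerivAt.comp_hasDerivWithinAt s (hT.hasDerivWithinAt hL x hs.1)
      rw [h] at this
      exact this) t ⟨t.2, le_rfl⟩
  simpa [hT.zero] using h1

end Semigroup

namespace Data

variable {W : Type*} [MeasurableSpace W] {μ : Measure W} [IsProbabilityMeasure μ] {𝒟 : Data μ}

theorem T_one (t : ℝ≥0) : 𝒟.T t (one μ) = one μ :=
  𝒟.isC0Semigroup.apply_eq_of_generator 𝒟.isGenerator (ContinuousLinearMap.id ℝ (L2 μ))
    ⟨one μ, 𝒟.one_mem⟩ (fun t => by rw [𝒟.L_one, map_zero, map_zero]) t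

theorem inner_T_one (f : 𝒟.L.domain) (t : ℝ≥0) :
    inner ℝ (𝒟.T t f) (one μ) = inner ℝ (f : L2 μ) (one μ) := by
  have h := 𝒟.isC0Semigroup.apply_eq_of_generator 𝒟.isGenerator (innerSL ℝ (one μ)) f
    (fun t => by
      obtain ⟨y, -, hy⟩ :=
        (LinearPMap.mem_graph_iff 𝒟.L).1 (𝒟.isC0Semigroup.mem_graph 𝒟.isGenerator f t)
      rw [innerSL_apply_apply, real_inner_comm, ← inner_L_one y]
      exact congrArg (fun z => inner ℝ z (one μ)) hy.symm) t
  rw [innerSL_apply_apply, innerSL_apply_apply] at h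
  rw [real_inner_comm, h, real_inner_comm]

/-- The modified entropy `½ ‖f‖² + ε (B f, f)` decays at the rate `ε λ / 2`, where
`λ = ΛM / (1 + ΛM)`, and it is comparable to `½ ‖f‖²` since `‖B‖ ≤ ½`. -/
theorem norm_sq_decay {Λm ΛM c₁ c₂ ε : ℝ} (hΛM : 0 < ΛM) (hε : 0 ≤ ε) (hε1 : ε ≤ 1)
    (hA1 : 𝒟.AlgebraicRelation) (hA2 : 𝒟.MicroscopicCoercivity Λm)
    (hA3 : 𝒟.MacroscopicCoercivity ΛM) (hA4 : 𝒟.AuxiliaryBounds c₁ c₂)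
    (hεr : ε * ((1 + c₁ + c₂) * (1 + (1 + ΛM) / (2 * ΛM) * (1 + c₁ + c₂)) +
      1 / 2 * (ΛM / (1 + ΛM))) ≤ Λm)
    (f : 𝒟.L.domain) (hf : inner ℝ (f : L2 μ) (one μ) = 0) (t : ℝ≥0) :
    (1 - ε) * ‖𝒟.T t f‖ ^ 2 ≤
      (1 + ε) * Real.exp (-(1 / 4 * ε * (ΛM / (1 + ΛM))) * t) ^ 2 * ‖(f : L2 μ)‖ ^ 2 := by
  set κ : ℝ := 1 / 4 * ε * (ΛM / (1 + ΛM)) with hκ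
  have hκ0 : 0 ≤ κ := by positivity
  let H : L2 μ → ℝ := fun g => 1 / 2 * inner ℝ g g + ε * inner ℝ (𝒟.B g) g
  have hH : ∀ g, |H g - 1 / 2 * ‖g‖ ^ 2| ≤ ε * (1 / 2 * ‖g‖ ^ 2) := fun g => by
    have h1 : |inner ℝ (𝒟.B g) g| ≤ 1 / 2 * ‖g‖ ^ 2 := by
      have := mul_le_mul_of_nonneg_right (norm_B_le (𝒟 := 𝒟) g) (norm_nonneg g)
      have := abs_real_inner_le_norm (𝒟.B g) g
      linarith
    rw [← real_inner_self_eq_norm_sq] at h1 ⊢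
    rw [add_sub_cancel_left, abs_mul, abs_of_nonneg hε]
    exact mul_le_mul_of_nonneg_left h1 hε
  have hHc : Continuous H := by fun_prop
  let u : ℝ → L2 μ := fun s => 𝒟.T s.toNNReal f
  let v : ℝ → L2 μ := fun s => 𝒟.T s.toNNReal (𝒟.L f)
  have hu : Continuous u := 𝒟.isC0Semigroup.continuous_toNNReal _
  have hder : ∀ s ∈ Set.Ico (0 : ℝ) t, HasDerivWithinAt
      (fun s => Real.exp (2 * κ * s) * H (u s))
      (Real.exp (2 * κ * s) * (2 * κ * H (u s) + (inner ℝ (v s) (u s) +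
        ε * (inner ℝ (𝒟.B (v s)) (u s) + inner ℝ (𝒟.B (u s)) (v s))))) (Set.Ici s) s := by
    intro s hs
    have h1 : HasDerivWithinAt u (v s) (Set.Ici s) s :=
      𝒟.isC0Semigroup.hasDerivWithinAt 𝒟.isGenerator f hs.1
    have h2 : HasDerivWithinAt (fun s => 𝒟.B (u s)) (𝒟.B (v s)) (Set.Ici s) s :=
      𝒟.B.hasFDerivAt.comp_hasDerivWithinAt s h1
    have h3 := ((h1.inner ℝ h1).const_mul (1 / 2)).add ((h2.inner ℝ h1).const_mul ε)
    have h4 : HasDerivWithinAt (fun s => Real.exp (2 * κ * s))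
        (Real.exp (2 * κ * s) * (2 * κ)) (Set.Ici s) s := by
      have := ((hasDerivAt_id s).const_mul (2 * κ)).exp.hasDerivWithinAt (s := Set.Ici s)
      simpa using this
    refine (h4.mul h3).congr_deriv ?_
    rw [real_inner_comm (v s) (u s)]
    simp only [H, Pi.add_apply]
    ring
  have hbound : ∀ s ∈ Set.Ico (0 : ℝ) t,
      Real.exp (2 * κ * s) * (2 * κ * H (u s) + (inner ℝ (v s) (u s) +
        ε * (inner ℝ (𝒟.B (v s)) (u s) + inner ℝ (𝒟.B (u s)) (v s)))) ≤ 0 := by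
    intro s hs
    refine mul_nonpos_of_nonneg_of_nonpos (Real.exp_pos _).le ?_
    obtain ⟨y, hy1, hy2⟩ :=
      (LinearPMap.mem_graph_iff 𝒟.L).1 (𝒟.isC0Semigroup.mem_graph 𝒟.isGenerator f s.toNNReal)
    dsimp only at hy1 hy2
    have h1 := dissipation hΛM hε hA1 hA2 hA3 hA4 hεr y (by rw [hy1, inner_T_one, hf])
    rw [hy1, hy2] at h1
    change _ ≤ -(ε * (1 / 2 * (ΛM / (1 + ΛM))) * ‖u s‖ ^ 2) at h1
    have h2 := (abs_le.1 (hH (u s))).2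
    have h3 : 2 * κ * H (u s) ≤ 2 * κ * ‖u s‖ ^ 2 :=
      mul_le_mul_of_nonneg_left (by nlinarith [sq_nonneg ‖u s‖]) (by linarith)
    have h4 : 2 * κ * ‖u s‖ ^ 2 = ε * (1 / 2 * (ΛM / (1 + ΛM))) * ‖u s‖ ^ 2 := by
      rw [hκ]
      ring
    linarith
  have hexp : Continuous fun s : ℝ => Real.exp (2 * κ * s) := by fun_prop
  have hle := image_le_of_deriv_right_le_deriv_boundary
    (hexp.mul (hHc.comp hu)).continuousOn hder
    (B := fun _ => H f) (B' := fun _ => 0) (by simp [u, 𝒟.isC0Semigroup.zero])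
    continuousOn_const (fun _ _ => hasDerivWithinAt_const _ _ _) hbound
    (x := t) ⟨t.2, le_rfl⟩
  have hut : u t = 𝒟.T t f := by simp only [u, Real.toNNReal_coe]
  rw [Pi.mul_apply, Function.comp_apply, hut] at hle
  have h1 := (abs_le.1 (hH (𝒟.T t f))).1
  have h2 := (abs_le.1 (hH f)).2
  have hexp2 : Real.exp (-κ * t) ^ 2 * Real.exp (2 * κ * t) = 1 := by
    rw [sq, ← Real.exp_add, ← Real.exp_add, ← Real.exp_zero]
    congr 1
    ring
  have h3 := mul_le_mul_of_nonneg_left (hle.trans (sub_le_iff_le_add.1 h2))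
    (sq_nonneg (Real.exp (-κ * t)))
  rw [← mul_assoc, hexp2, one_mul] at h3
  linarith

/-- The entropy decay with `ε = (θ - 1) / θ * m`, extended to the whole space by density of `D`. -/
theorem norm_T_sub_mean_le {Λm ΛM c₁ c₂ θ m : ℝ} (hΛM : 0 < ΛM) (hθ : 1 < θ)
    (hm : 0 ≤ m) (hm1 : m ≤ 1)
    (hA1 : 𝒟.AlgebraicRelation) (hA2 : 𝒟.MicroscopicCoercivity Λm)
    (hA3 : 𝒟.MacroscopicCoercivity ΛM) (hA4 : 𝒟.AuxiliaryBounds c₁ c₂)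
    (hmr : m * ((1 + c₁ + c₂) * (1 + (1 + ΛM) / (2 * ΛM) * (1 + c₁ + c₂)) +
      1 / 2 * (ΛM / (1 + ΛM))) ≤ Λm) (hΛm : 0 < Λm) (g : L2 μ) (t : ℝ≥0) :
    ‖𝒟.T t g - mean μ g‖ ≤
      θ * Real.exp (-(1 / 4 * ((θ - 1) / θ) * m * (ΛM / (1 + ΛM))) * t) * ‖g - mean μ g‖ := by
  have hθ0 : 0 < θ := by linarith
  have hq0 : 0 ≤ (θ - 1) / θ := div_nonneg (by linarith) hθ0.le
  have hq1 : (θ - 1) / θ ≤ 1 := by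
    rw [div_le_one hθ0]
    linarith
  set ε : ℝ := (θ - 1) / θ * m with hε
  have hε0 : 0 ≤ ε := mul_nonneg hq0 hm
  have hεq : ε ≤ (θ - 1) / θ := mul_le_of_le_one_right hq0 hm1
  have hεr : ε * ((1 + c₁ + c₂) * (1 + (1 + ΛM) / (2 * ΛM) * (1 + c₁ + c₂)) +
      1 / 2 * (ΛM / (1 + ΛM))) ≤ Λm := by
    rw [hε, mul_assoc]
    nlinarith [mul_le_mul_of_nonneg_left hmr hq0]
  have hmul : (θ - 1) / θ * θ = θ - 1 := div_mul_cancel₀ _ hθ0.ne'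
  have hεθ : ε * θ ≤ θ - 1 := by nlinarith
  have hε1 : ε < 1 := by nlinarith
  -- Since `ε ≤ (θ - 1) / θ`, one has `(1 + ε) / (1 - ε) ≤ 2 θ - 1 ≤ θ²`.
  have hratio : 1 + ε ≤ (1 - ε) * θ ^ 2 := by nlinarith
  have hrate : 1 / 4 * ((θ - 1) / θ) * m * (ΛM / (1 + ΛM)) = 1 / 4 * ε * (ΛM / (1 + ΛM)) := by
    rw [hε]
    ring
  rw [hrate]
  have hmc : Continuous fun g : L2 μ => mean μ g := by
    unfold mean
    fun_prop
  have hs : IsClosed {g : L2 μ | ‖𝒟.T t g - mean μ g‖ ≤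
      θ * Real.exp (-(1 / 4 * ε * (ΛM / (1 + ΛM))) * t) * ‖g - mean μ g‖} :=
    isClosed_le (by fun_prop) (by fun_prop)
  refine hs.closure_subset_iff.2 (fun g hg => ?_) (𝒟.dense_D g)
  have hmean : mean μ g ∈ 𝒟.L.domain := 𝒟.L.domain.smul_mem _ 𝒟.one_mem
  let f : 𝒟.L.domain := ⟨g - mean μ g, 𝒟.L.domain.sub_mem (𝒟.core.le_domain hg) hmean⟩
  have hf : inner ℝ (f : L2 μ) (one μ) = 0 := by
    change inner ℝ (g - (inner ℝ g (one μ) : ℝ) • one μ) (one μ) = 0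
    rw [inner_sub_left, real_inner_smul_left, real_inner_self_eq_norm_sq, norm_one_eq]
    ring
  have hTf : 𝒟.T t g - mean μ g = 𝒟.T t f := by
    change _ = 𝒟.T t (g - (inner ℝ g (one μ) : ℝ) • one μ)
    rw [map_sub, map_smul, T_one]
    rfl
  have h := norm_sq_decay hΛM hε0 hε1.le hA1 hA2 hA3 hA4 hεr f hf t
  change ‖𝒟.T t g - mean μ g‖ ≤ _ * ‖(f : L2 μ)‖
  rw [hTf]
  refine abs_le_of_sq_le_sq' ?_ (by positivity) |>.2
  rw [mul_pow, mul_pow]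
  refine le_of_mul_le_mul_left (h.trans ?_) (sub_pos.2 hε1)
  rw [mul_assoc, mul_assoc (θ ^ 2), ← mul_assoc (1 - ε)]
  exact mul_le_mul_of_nonneg_right hratio (by positivity)

theorem rate_estimate {Λm ΛM c₁ c₂ θ : ℝ} (hΛm : 0 < Λm) (hΛM : 0 < ΛM) (hθ : 1 < θ)
    (hA1 : 𝒟.AlgebraicRelation) (hA2 : 𝒟.MicroscopicCoercivity Λm)
    (hA3 : 𝒟.MacroscopicCoercivity ΛM) (hA4 : 𝒟.AuxiliaryBounds c₁ c₂) (g : L2 μ) (t : ℝ≥0) :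
    ‖𝒟.T t g - mean μ g‖ ≤
      θ * Real.exp (-rate Λm ΛM c₁ c₂ θ * t) * ‖g - mean μ g‖ := by
  obtain ⟨h1, h2⟩ := hA4.nonneg hΛM hA1 hA3
  have hden : 1 + c₁ ≤ (1 + c₁ + c₂) * (1 + (1 + ΛM) / (2 * ΛM) * (1 + c₁ + c₂)) +
      1 / 2 * (ΛM / (1 + ΛM)) := by
    have hl : 0 ≤ 1 / 2 * (ΛM / (1 + ΛM)) := by positivity
    have hp : 0 ≤ (1 + c₁ + c₂) * ((1 + ΛM) / (2 * ΛM) * (1 + c₁ + c₂)) := by positivity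
    rw [mul_add, mul_one]
    linarith
  refine norm_T_sub_mean_le hΛM hθ (div_nonneg (le_min hΛm.le h1) (by linarith))
    ((div_le_one (by linarith)).2 ?_) hA1 hA2 hA3 hA4 ?_ hΛm g t
  · exact (min_le_right _ _).trans (by linarith)
  · rw [div_mul_cancel₀ _ (by linarith)]
    exact min_le_left _ _

end Data

theorem rate_pos {Λm ΛM c₁ c₂ θ : ℝ} (hΛm : 0 < Λm) (hΛM : 0 < ΛM) (hc₁ : 0 < c₁) (hc₂ : 0 ≤ c₂)
    (hθ : 1 < θ) : 0 < rate Λm ΛM c₁ c₂ θ := by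
  have h1 : 0 < (θ - 1) / θ := div_pos (by linarith) (by linarith)
  have h2 : 0 < min Λm c₁ := lt_min hΛm hc₁
  unfold rate
  positivity

end Hypocoercivity

theorem theorem5p2 {W : Type*} [MeasurableSpace W] (μ : Measure W) [IsProbabilityMeasure μ]
    (𝒟 : Hypocoercivity.Data μ) (Λm ΛM c₁ c₂ : ℝ) (hΛm : 0 < Λm) (hΛM : 0 < ΛM)
    (hA1 : 𝒟.AlgebraicRelation) (hA2 : 𝒟.MicroscopicCoercivity Λm)
    (hA3 : 𝒟.MacroscopicCoercivity ΛM) (hA4 : 𝒟.AuxiliaryBounds c₁ c₂)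
    (θ₁ : ℝ) (hθ₁ : 1 < θ₁) :
    (∃ θ₂ : ℝ, 0 < θ₂ ∧ ∀ (g : Hypocoercivity.L2 μ) (t : ℝ≥0),
      ‖𝒟.T t g - Hypocoercivity.mean μ g‖ ≤
        θ₁ * Real.exp (-θ₂ * t) * ‖g - Hypocoercivity.mean μ g‖) ∧
    (0 < c₁ → 0 < Hypocoercivity.rate Λm ΛM c₁ c₂ θ₁) ∧
    (∀ (g : Hypocoercivity.L2 μ) (t : ℝ≥0),
      ‖𝒟.T t g - Hypocoercivity.mean μ g‖ ≤
        θ₁ * Real.exp (-Hypocoercivity.rate Λm ΛM c₁ c₂ θ₁ * t) *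
          ‖g - Hypocoercivity.mean μ g‖) := by
  obtain ⟨h1, h2⟩ := hA4.nonneg hΛM hA1 hA3
  -- If `c₁ = 0` the explicit rate vanishes; a positive one comes from enlarging `c₁`.
  have hA4' : 𝒟.AuxiliaryBounds (c₁ + 1) c₂ := fun f hf =>
    ⟨(hA4 f hf).1.trans (mul_le_mul_of_nonneg_right (by linarith) (norm_nonneg _)), (hA4 f hf).2⟩
  exact ⟨⟨Hypocoercivity.rate Λm ΛM (c₁ + 1) c₂ θ₁,
      Hypocoercivity.rate_pos hΛm hΛM (by linarith) h2 hθ₁,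
      Hypocoercivity.Data.rate_estimate hΛm hΛM hθ₁ hA1 hA2 hA3 hA4'⟩,
    fun hc => Hypocoercivity.rate_pos hΛm hΛM hc h2 hθ₁,
    Hypocoercivity.Data.rate_estimate hΛm hΛM hθ₁ hA1 hA2 hA3 hA4⟩
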